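/- Let $(\Theta,\mathcal F)$ and $(\mathscr D,\mathcal A)$ be measurable spaces with $\sigma$-finite measures $\mu$ on $\Theta$ and $\nu$ on $\mathscr D$. For a set $\mathcal S$ of (countably additive) probability measures on a measurable space write $\overline S(A)=\sup_{P\in\mathcal S}P(A)$ for its upper probability, $\underline S(A)=1-\overline S(A^c)$ for the conjugate lower probability, and $\mathrm{core}(\overline S)$ for the set of all (countably additive) probability measures $Q$ with $Q(A)\le\overline S(A)$ for all measurable $A$. Let $\mathcal P$ be a set of probability measures on $(\Theta,\mathcal F)$ with upper and lower probabilities $\overline P,\underline P$ and let $\mathcal P^{\mathrm{co}}=\mathrm{core}(\overline P)$. Suppose that $\mathcal P^{\mathrm{co}}$ is nonempty and weak$^\star$-closed (closed under setwise limits of nets, within the finitely additive probabilities), and that every $P\in\mathcal P^{\mathrm{co}}$ is absolutely continuous with respect to $\mu$. For each $\theta\in\Theta$ let $\mathcal L_\theta$ be a set of probability measures on $(\mathscr D,\mathcal A)$ with upper probability $\overline P_\theta$, let $\mathcal L_\theta^{\mathrm{co}}=\mathrm{core}(\overline P_\theta)$, and fix for each $P_\theta\in\mathcal L_\theta^{\mathrm{co}}$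 a density with respect to $\nu$. Fix $y\in\mathscr D$. Let $\mathscr L$ be the set of likelihood functions $L(\theta)=\frac{dP_\theta}{d\nu}(y)$, $\theta\in\Theta$, where $P_\theta\in\mathcal L_\theta^{\mathrm{co}}$ for each $\theta$, and assume that every $L\in\mathscr L$ is bounded, non-negative and measurable. Put $\overline L(\theta)=\sup_{L\in\mathscr L}L(\theta)$, $\underline L(\theta)=\inf_{L\in\mathscr L}L(\theta)$. Let $\mathcal P_y^{\mathrm{co}}$ be the set of probability measures on $\Theta$ with $\mu$-density $\frac{L\,p}{\int_\Theta L\,p\,d\mu}$, where $p=dP/d\mu$, $P\in\mathcal P^{\mathrm{co}}$, $L\in\mathscr L$ and $\int_\Theta L\,p\,d\mu>0$, and let $\overline P_y(A)=\sup_{P_y\in\mathcal P_y^{\mathrm{co}}}P_y(A)$. Suppose that $\mathcal L_\theta^{\mathrm{co}}$ is a singleton $\{P_\theta\}$ for every $\theta$ (so that it is nonempty and weak$^\star$-closed), and let $L(\theta)=\frac{dP_\theta}{d\nu}(y)$. Then $\overline L=\underline L=L$; the set $\mathcal P_y^{\mathrm{co}}$ consists exactly of the probability measures $A\mapsto\int_A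 L\,dP\big/\int_\Theta L\,dP$ with $P\in\mathcal P^{\mathrm{co}}$ and $\int_\Theta L\,dP>0$; and for every $A\in\mathcal F$ $$\overline P_y(A)\;\le\;\frac{\sup_{P\in\mathcal P^{\mathrm{co}}}\int_\Theta L\mathbb 1_A\,dP}{\mathbf c}\;\le\;\frac{\int_0^\infty\overline P(\{\theta: L(\theta)\mathbb 1_A(\theta)>t\})\,dt}{\mathbf c'},$$ where $$\mathbf c=\sup_{P\in\mathcal P^{\mathrm{co}}}\int_\Theta L\mathbb 1_A\,dP+\inf_{P\in\mathcal P^{\mathrm{co}}}\int_\Theta L\mathbb 1_{A^c}\,dP,$$ $$\mathbf c'=\int_0^\infty\overline P(\{\theta: L(\theta)\mathbb 1_A(\theta)>t\})\,dt+\int_0^\infty\underline P(\{\theta: L(\theta)\mathbb 1_{A^c}(\theta)>t\})\,dt;$$ the first inequality holds whenever $\mathbf c>0$, and the second whenever $\mathbf c'>0$ (in which case also $\mathbf c>0$). If moreover $\overline P$ is concave, that is, $\overline P(A\cup B)\le\overline P(A)+\overline P(B)-\overline P(A\cap B)$ for all $A,B\in\mathcal F$, then both inequalities are equalities for all $A\in\mathcal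 F$, under the same provisos. -/

import Mathlib

open MeasureTheory

noncomputable section

namespace ImpreciseBayes

/-- Upper probability of a set of (countably additive) probability measures. -/
def upper {Ω : Type*} [MeasurableSpace Ω] (S : Set (ProbabilityMeasure Ω)) (A : Set Ω) : ℝ :=
  sSup ((fun P : ProbabilityMeasure Ω => (P : Measure Ω).real A) '' S)

/-- The conjugate lower probability. -/
def lower {Ω : Type*} [MeasurableSpace Ω] (S : Set (ProbabilityMeasure Ω)) (A : Set Ω) : ℝ :=
  1 - upper S Aᶜ

/-- The (countably additive) core of a set function: all probability measures that it dominates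
on every measurable set. -/
def core {Ω : Type*} [MeasurableSpace Ω] (u : Set Ω → ℝ) : Set (ProbabilityMeasure Ω) :=
  {P | ∀ A, MeasurableSet A → (P : Measure Ω).real A ≤ u A}

/-- Concavity (2-alternation) of a set function on the measurable sets. -/
def Concave {Ω : Type*} [MeasurableSpace Ω] (u : Set Ω → ℝ) : Prop :=
  ∀ A B, MeasurableSet A → MeasurableSet B → u (A ∪ B) ≤ u A + u B - u (A ∩ B)

/-- Weak-star closedness: a limit of a setwise convergent net from `C` is again in `C`, where the
limit may a priori be only a finitely additive probability.  As the finitely additive probabilities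
are closed in the space of all set functions with the topology of setwise convergence,
this is closedness in that space. -/
def WeakStarClosed {Ω : Type*} [MeasurableSpace Ω] (C : Set (ProbabilityMeasure Ω)) : Prop :=
  IsClosed ((fun (P : ProbabilityMeasure Ω) (A : {A : Set Ω // MeasurableSet A}) =>
    (P : Measure Ω).real (A : Set Ω)) '' C)

/-- `p` is a (version of the) density of `Q` with respect to `ν`. -/
def IsDensity {D : Type*} [MeasurableSpace D] (ν : Measure D) (Q : ProbabilityMeasure D)
    (p : D → ℝ) : Prop :=
  Measurable p ∧ (∀ z, 0 ≤ p z) ∧ (Q : Measure D) = ν.withDensity (fun z => ENNReal.ofReal (p z))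

/-- The bounded, non-negative, measurable functionals on `Θ`. -/
def BddNonnegMeasurable (Θ : Type*) [MeasurableSpace Θ] : Set (Θ → ℝ) :=
  {L | Measurable L ∧ (∀ θ, 0 ≤ L θ) ∧ ∃ M, ∀ θ, L θ ≤ M}

/-- The plausible likelihood functions `θ ↦ p(y ∣ θ)` at the observation `y`: for each `θ` a sampling
distribution `Q θ` is picked from the likelihood core at `θ`, and its density (the fixed version
`dens θ (Q θ)`) is evaluated at `y`. -/
def likelihoods {Θ D : Type*} [MeasurableSpace D] (ℒ : Θ → Set (ProbabilityMeasure D))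
    (dens : Θ → ProbabilityMeasure D → D → ℝ) (y : D) : Set (Θ → ℝ) :=
  {L | ∃ Q : Θ → ProbabilityMeasure D, (∀ θ, Q θ ∈ core (upper (ℒ θ))) ∧
    ∀ θ, L θ = dens θ (Q θ) y}

/-- The upper likelihood, `θ ↦ sup L θ` over a class of likelihood functions. -/
def upperLikelihood {Θ : Type*} (𝓛 : Set (Θ → ℝ)) (θ : Θ) : ℝ := sSup ((fun L => L θ) '' 𝓛)

/-- The lower likelihood, `θ ↦ inf L θ` over a class of likelihood functions. -/
def lowerLikelihood {Θ : Type*} (𝓛 : Set (Θ → ℝ)) (θ : Θ) : ℝ := sInf ((fun L => L θ) '' 𝓛)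

/-- The class of posteriors for priors in `C` and likelihood functions in `𝓛`: with `p = dP/dμ` the
prior density, the posterior has density `L p / ∫ L p dμ` with respect to `μ`. -/
def posteriors {Θ : Type*} [MeasurableSpace Θ] (μ : Measure Θ) (C : Set (ProbabilityMeasure Θ))
    (𝓛 : Set (Θ → ℝ)) : Set (ProbabilityMeasure Θ) :=
  {R | ∃ P ∈ C, ∃ L ∈ 𝓛,
    0 < ∫ θ, L θ * ((P : Measure Θ).rnDeriv μ θ).toReal ∂μ ∧
    (R : Measure Θ) = μ.withDensity (fun θ => ENNReal.ofReal
      (L θ * ((P : Measure Θ).rnDeriv μ θ).toReal /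
        ∫ τ, L τ * ((P : Measure Θ).rnDeriv μ τ).toReal ∂μ))}

/-- The posteriors for priors in `C` and one precise likelihood function `L`, by Bayes' rule
`R(A) = ∫_A L dP / ∫ L dP`. -/
def precisePosteriors {Θ : Type*} [MeasurableSpace Θ] (C : Set (ProbabilityMeasure Θ))
    (L : Θ → ℝ) : Set (ProbabilityMeasure Θ) :=
  {R | ∃ P ∈ C, 0 < ∫ θ, L θ ∂(P : Measure Θ) ∧ ∀ A, MeasurableSet A →
    (R : Measure Θ).real A = (∫ θ in A, L θ ∂(P : Measure Θ)) / ∫ θ, L θ ∂(P : Measure Θ)}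

/-- `sup` over `P ∈ C` of `∫ f dP`. -/
def upperExp {Θ : Type*} [MeasurableSpace Θ] (C : Set (ProbabilityMeasure Θ)) (f : Θ → ℝ) : ℝ :=
  sSup ((fun P : ProbabilityMeasure Θ => ∫ θ, f θ ∂(P : Measure Θ)) '' C)

/-- `inf` over `P ∈ C` of `∫ f dP`. -/
def lowerExp {Θ : Type*} [MeasurableSpace Θ] (C : Set (ProbabilityMeasure Θ)) (f : Θ → ℝ) : ℝ :=
  sInf ((fun P : ProbabilityMeasure Θ => ∫ θ, f θ ∂(P : Measure Θ)) '' C)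

/-- Choquet integral of a non-negative `f` with respect to a set function `u`. -/
def choquet {Θ : Type*} (u : Set Θ → ℝ) (f : Θ → ℝ) : ℝ :=
  ∫ t in Set.Ioi (0 : ℝ), u {θ | t < f θ}

/-- The normalizer `sup_P ∫ Lu 1_A dP + inf_P ∫ Ll 1_{Aᶜ} dP`, for an upper likelihood `Lu` and a
lower likelihood `Ll`. -/
def expNormalizer {Θ : Type*} [MeasurableSpace Θ] (C : Set (ProbabilityMeasure Θ))
    (Lu Ll : Θ → ℝ) (A : Set Θ) : ℝ :=
  upperExp C (A.indicator Lu) + lowerExp C (Aᶜ.indicator Ll)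

/-- The normalizer formed by the upper Choquet integral of `Lu 1_A` and the lower Choquet integral of
`Ll 1_{Aᶜ}`. -/
def choquetNormalizer {Θ : Type*} [MeasurableSpace Θ] (Pr : Set (ProbabilityMeasure Θ))
    (Lu Ll : Θ → ℝ) (A : Set Θ) : ℝ :=
  choquet (upper Pr) (A.indicator Lu) + choquet (lower Pr) (Aᶜ.indicator Ll)

end ImpreciseBayes

end

open ImpreciseBayes

/-! The posterior probability of A under a prior P is x/(x+z), where x = ∫_A L dP and z = ∫_{Aᶜ} L
dP; it increases in x and decreases in z. Replacing x by its supremum and z by its infimum over the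
core gives the first bound. Enlarging that supremum to the upper Choquet integral and shrinking the
infimum to the lower one gives the second; the layer-cake formula reduces this comparison to one
level t at a time.

Equality needs a single prior in the core attaining both extremes. At positive levels the superlevel
sets of L 1_A lie inside A, and the complements of those of L 1_{Aᶜ} contain A, so together they
form a chain. It suffices that some core member agrees with the upper probability on that chain
(`exists_mem_core_eq_upper_on_chain`). Concavity is submodularity, and
`NormalizedSubmodular.exists_additive` uses Zorn's lemma to find a finitely additive minorant that
agrees on the chain. Weak-star closedness, through compactness, makes the upper probability
continuous at ∅, which forces the minorant to be countably additive. -/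

/-- A set function on a Boolean algebra that is submodular, vanishes at `⊥` and is `1` at `⊤`. -/
structure NormalizedSubmodular {α : Type*} [BooleanAlgebra α] (v : α → ℝ) : Prop where
  bot : v ⊥ = 0
  top : v ⊤ = 1
  sub : ∀ a b, v (a ⊔ b) + v (a ⊓ b) ≤ v a + v b

/-! ### Additive minorants of submodular functions. -/

namespace NormalizedSubmodular

variable {α : Type*} [BooleanAlgebra α] {u v : α → ℝ}

theorem one_le_add_compl (hv : NormalizedSubmodular v) (a : α) : 1 ≤ v a + v aᶜ := by
  have := hv.sub a aᶜ
  rw [sup_compl_eq_top, inf_compl_eq_bot, hv.bot, hv.top] at this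
  linarith

/-- `a ↦ v (a ⊓ b) + v (a ⊔ b) - v b` is submodular. -/
theorem modularize (hv : NormalizedSubmodular v) (b : α) :
    NormalizedSubmodular (fun a => v (a ⊓ b) + v (a ⊔ b) - v b) where
  bot := by simp [hv.bot]
  top := by simp [hv.top]
  sub := fun a a' => by
    -- By distributivity, meeting and joining with b preserve ⊔ and ⊓, so each summand is submodular
    -- separately.
    have h1 := hv.sub (a ⊓ b) (a' ⊓ b)
    have h2 := hv.sub (a ⊔ b) (a' ⊔ b)
    rw [← inf_sup_right, ← inf_inf_distrib_right] at h1
    rw [← sup_inf_right, ← sup_sup_distrib_right] at h2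
    linarith

/-- Below a normalized submodular function there is a minimal one among those with the same values
on a given set. -/
theorem exists_minimal (hu : NormalizedSubmodular u) (K : Set α) :
    ∃ v, Minimal (fun v => NormalizedSubmodular v ∧ v ≤ u ∧ ∀ a ∈ K, v a = u a) v := by
  -- Passing to the order dual lets Zorn's lemma for maximal elements produce a minimal one.
  set S : Set (α → ℝ)ᵒᵈ :=
    {v | NormalizedSubmodular (OrderDual.ofDual v) ∧ OrderDual.ofDual v ≤ u ∧
      ∀ a ∈ K, OrderDual.ofDual v a = u a} with hS
  have key : ∃ m, (OrderDual.toDual u) ≤ m ∧ Maximal (· ∈ S) m := by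
    refine zorn_le_nonempty₀ S ?_ _ ⟨hu, le_rfl, fun _ _ => rfl⟩
    intro c hcS hc v₀ hv₀
    have : Nonempty c := ⟨⟨v₀, hv₀⟩⟩
    have hbdd : ∀ a, BddBelow (Set.range fun v : c => OrderDual.ofDual v.1 a) := by
      -- From 1 ≤ v a + v aᶜ and v ≤ u.
      refine fun a => ⟨1 - u aᶜ, ?_⟩
      rintro _ ⟨v, rfl⟩
      have h1 := (hcS v.2).1.one_le_add_compl a
      have h2 := (hcS v.2).2.1 aᶜ
      simp only
      linarith
    refine ⟨OrderDual.toDual fun a => ⨅ v : c, OrderDual.ofDual v.1 a, ⟨⟨?_, ?_, ?_⟩, ?_, ?_⟩, ?_⟩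
    · exact (congrArg iInf (funext fun v : c => (hcS v.2).1.bot)).trans (ciInf_const)
    · exact (congrArg iInf (funext fun v : c => (hcS v.2).1.top)).trans (ciInf_const)
    · intro a b
      refine le_ciInf_add_ciInf fun v w => ?_
      -- The infima at a and b are approached by different v and w; the smaller of the two in the
      -- chain serves for both.
      have aux : ∀ x : c, OrderDual.ofDual x.1 a ≤ OrderDual.ofDual v.1 a →
          OrderDual.ofDual x.1 b ≤ OrderDual.ofDual w.1 b →
          (⨅ v : c, OrderDual.ofDual v.1 (a ⊔ b)) + (⨅ v : c, OrderDual.ofDual v.1 (a ⊓ b))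
            ≤ OrderDual.ofDual v.1 a + OrderDual.ofDual w.1 b := by
        intro x h1 h2
        have h3 := ciInf_le (hbdd (a ⊔ b)) x
        have h4 := ciInf_le (hbdd (a ⊓ b)) x
        have h5 := (hcS x.2).1.sub a b
        linarith
      rcases hc.total v.2 w.2 with h | h
      · exact aux w (h a) le_rfl
      · exact aux v le_rfl (h b)
    · exact fun a => (ciInf_le (hbdd a) ⟨v₀, hv₀⟩).trans ((hcS hv₀).2.1 a)
    · exact fun a ha => (congrArg iInf (funext fun v : c => (hcS v.2).2.2 a ha)).trans ciInf_const
    · exact fun v hv a => ciInf_le (hbdd a) ⟨v, hv⟩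
  obtain ⟨m, -, hm⟩ := key
  exact ⟨OrderDual.ofDual m, hm.1, fun w hw hle => hm.2 hw hle⟩

theorem modularize_le (hv : NormalizedSubmodular v) (b a : α) :
    v (a ⊓ b) + v (a ⊔ b) - v b ≤ v a := by
  have := hv.sub a b
  linarith

/-- A normalized submodular function dominates a finitely additive one with the same values on a
given chain. -/
theorem exists_additive (hu : NormalizedSubmodular u) (K : Set α) (hK : IsChain (· ≤ ·) K) :
    ∃ m : α → ℝ, m ≤ u ∧ (∀ a ∈ K, m a = u a) ∧ m ⊤ = 1 ∧ (∀ a, m aᶜ = 1 - m a) ∧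
      ∀ a b, Disjoint a b → m (a ⊔ b) = m a + m b := by
  obtain ⟨v, ⟨hv, hvu, hvK⟩, hvmin⟩ := hu.exists_minimal K
  have hvc : ∀ b ∈ K, v b + v bᶜ = 1 := by
    intro b hb
    -- The modularization at b is a competitor: a ∈ K is comparable with b, so its value at a is
    -- unchanged. Its value at bᶜ is 1 - v b, so minimality gives v bᶜ ≤ 1 - v b.
    have h := hvmin (y := fun a => v (a ⊓ b) + v (a ⊔ b) - v b)
      ⟨hv.modularize b, fun a => (hv.modularize_le b a).trans (hvu a), fun a ha => by
        rcases hK.total ha hb with h | h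
        · simp [inf_eq_left.2 h, sup_eq_right.2 h, hvK a ha]
        · simp [inf_eq_right.2 h, sup_eq_left.2 h, hvK a ha]⟩ (hv.modularize_le b) bᶜ
    have h2 := hv.one_le_add_compl b
    simp only [compl_inf_eq_bot, compl_sup_eq_top, hv.bot, hv.top] at h
    linarith
  -- With no prescribed values, modularization at every b becomes a competitor. The values on K
  -- survive anyway, since v is already self-conjugate there.
  obtain ⟨m, ⟨hm, hmv, -⟩, hmmin⟩ := hv.exists_minimal ∅
  have hmc : ∀ b, m bᶜ = 1 - m b := by
    intro b
    have h := hmmin (y := fun a => m (a ⊓ b) + m (a ⊔ b) - m b)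
      ⟨hm.modularize b, fun a => (hm.modularize_le b a).trans (hmv a), by simp⟩
      (hm.modularize_le b) bᶜ
    have h2 := hm.one_le_add_compl b
    simp only [compl_inf_eq_bot, compl_sup_eq_top, hm.bot, hm.top] at h
    linarith
  refine ⟨m, hmv.trans hvu, fun a ha => ?_, hm.top, hmc, fun a b hab => ?_⟩
  · have h1 := hmv aᶜ
    have h2 := hvc a ha
    have h3 := hmv a
    rw [hmc] at h1
    rw [← hvK a ha]
    linarith
  -- Submodularity at the complements is supermodularity at a and b.
  · have h1 := hm.sub a b
    have h2 := hm.sub aᶜ bᶜ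
    rw [hab.eq_bot, hm.bot] at h1
    rw [← compl_inf, ← compl_sup, hab.eq_bot, hmc, hmc, hmc, hmc, hm.bot] at h2
    linarith

end NormalizedSubmodular

/-! ### Countable additivity and continuity at ∅. -/

section ImpreciseProbability

open Filter Topology

variable {Ω : Type*} [MeasurableSpace Ω]

/-- A finitely additive probability that is continuous at `∅` is countably additive. -/
theorem exists_probabilityMeasure_of_tendsto_zero (m : {A : Set Ω // MeasurableSet A} → ℝ)
    (hnn : ∀ A, 0 ≤ m A) (htop : m ⊤ = 1) (hadd : ∀ A B, Disjoint A B → m (A ⊔ B) = m A + m B)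
    (hcont : ∀ A : ℕ → {A : Set Ω // MeasurableSet A}, Antitone A → ⋂ n, (A n : Set Ω) = ∅ →
      Tendsto (fun n => m (A n)) atTop (𝓝 0)) :
    ∃ P : ProbabilityMeasure Ω, ∀ A : {A : Set Ω // MeasurableSet A},
      (P : Measure Ω).real (A : Set Ω) = m A := by
  have hbot : m ⊥ = 0 := by
    have := hadd ⊥ ⊥ disjoint_bot_left
    rw [sup_idem] at this
    linarith
  have hσ : ∀ f : ℕ → Set Ω, ∀ h : ∀ i, MeasurableSet (f i), Pairwise (Function.onFun Disjoint f) →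
      ENNReal.ofReal (m ⟨⋃ i, f i, MeasurableSet.iUnion h⟩) =
        ∑' i, ENNReal.ofReal (m ⟨f i, h i⟩) := by
    intro f h hd
    have hr : ∀ n, MeasurableSet (⋃ i, f (i + n)) := fun n => MeasurableSet.iUnion fun i => h _
    have hsplit : ∀ n, m ⟨⋃ i, f i, MeasurableSet.iUnion h⟩ =
        (∑ i ∈ Finset.range n, m ⟨f i, h i⟩) + m ⟨⋃ i, f (i + n), hr n⟩ := by
      intro n
      induction n with
      | zero => simp
      | succ n ih =>
        rw [ih, Finset.sum_range_succ, add_assoc]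
        congr 1
        rw [← hadd]
        · congr 1
          apply Subtype.ext
          change (⋃ i, f (i + n)) = f n ∪ ⋃ i, f (i + (n + 1))
          rw [← Set.union_iUnion_nat_succ]
          simp [add_assoc, add_comm 1 n]
        · rw [disjoint_iff]
          apply Subtype.ext
          change f n ∩ (⋃ i, f (i + (n + 1))) = ∅
          rw [← Set.disjoint_iff_inter_eq_empty, Set.disjoint_iUnion_right]
          exact fun i => hd (by omega)
    have htail : Tendsto (fun n => m ⟨⋃ i, f (i + n), hr n⟩) atTop (𝓝 0) := by
      refine hcont (fun n => ⟨⋃ i, f (i + n), hr n⟩) (antitone_nat_of_succ_le fun n => ?_) ?_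
      · change (⋃ i, f (i + (n + 1))) ⊆ ⋃ i, f (i + n)
        refine Set.iUnion_subset fun i => ?_
        rw [show i + (n + 1) = (i + 1) + n by ring]
        exact Set.subset_iUnion (fun i => f (i + n)) (i + 1)
      · refine Set.eq_empty_of_forall_notMem fun x hx => ?_
        simp only [Set.mem_iInter, Set.mem_iUnion] at hx
        obtain ⟨i, hi⟩ := hx 0
        obtain ⟨j, hj⟩ := hx (i + 1)
        exact Set.disjoint_left.1 (hd (show i + 0 ≠ j + (i + 1) by omega)) hi hj
    have hsum : HasSum (fun i => m ⟨f i, h i⟩) (m ⟨⋃ i, f i, MeasurableSet.iUnion h⟩) := by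
      rw [hasSum_iff_tendsto_nat_of_nonneg fun i => hnn _]
      have := (tendsto_const_nhds (x := m ⟨⋃ i, f i, MeasurableSet.iUnion h⟩)).sub htail
      rw [sub_zero] at this
      refine this.congr fun n => ?_
      have := hsplit n
      linarith
    rw [← hsum.tsum_eq, ENNReal.ofReal_tsum_of_nonneg (fun i => hnn _) hsum.summable]
  let P : Measure Ω := Measure.ofMeasurable (fun A hA => ENNReal.ofReal (m ⟨A, hA⟩))
    (by
      change ENNReal.ofReal (m ⊥) = 0
      simp [hbot]) (fun f h hd => hσ f h hd)
  have hP : ∀ A : {A : Set Ω // MeasurableSet A}, P A = ENNReal.ofReal (m A) :=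
    fun A => Measure.ofMeasurable_apply _ A.2
  have hprob : IsProbabilityMeasure P := ⟨by
    rw [show (Set.univ : Set Ω) = ((⊤ : {A : Set Ω // MeasurableSet A}) : Set Ω) from rfl, hP,
      htop, ENNReal.ofReal_one]⟩
  exact ⟨⟨P, hprob⟩, fun A => by
    change (P A).toReal = m A
    rw [hP, ENNReal.toReal_ofReal (hnn A)]⟩

/-- The members of a weak-star closed set of probability measures are uniformly continuous
at `∅`. -/
theorem ImpreciseBayes.WeakStarClosed.exists_forall_lt {C : Set (ProbabilityMeasure Ω)}
    (hC : WeakStarClosed C) (A : ℕ → {A : Set Ω // MeasurableSet A}) (hA : Antitone A)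
    (hempty : ⋂ n, (A n : Set Ω) = ∅) {ε : ℝ} (hε : 0 < ε) :
    ∃ n, ∀ P ∈ C, (P : Measure Ω).real (A n : Set Ω) < ε := by
  by_contra! hcon
  set I := (fun (P : ProbabilityMeasure Ω) (A : {A : Set Ω // MeasurableSet A}) =>
    (P : Measure Ω).real (A : Set Ω)) '' C with hI
  -- A closed subset of a product of copies of [0,1]. If uniformity failed, nested compact sets
  -- would share a point, which lies in the closed image and so is a countably additive P with P(A
  -- n) ≥ ε for all n.
  have hIc : IsCompact I := by
    refine (isCompact_univ_pi fun _ : {A : Set Ω // MeasurableSet A} =>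
      isCompact_Icc (a := (0 : ℝ)) (b := 1)).of_isClosed_subset hC ?_
    rintro _ ⟨P, -, rfl⟩ B -
    exact ⟨measureReal_nonneg, measureReal_le_one⟩
  have hcl : ∀ n, IsClosed {v : {A : Set Ω // MeasurableSet A} → ℝ | ε ≤ v (A n)} := fun n =>
    isClosed_le continuous_const (continuous_apply _)
  have hne := IsCompact.nonempty_iInter_of_sequence_nonempty_isCompact_isClosed
    (fun n => I ∩ {v | ε ≤ v (A n)}) ?_ ?_ (hIc.inter_right (hcl 0))
    (fun n => hC.inter (hcl n))
  · obtain ⟨v, hv⟩ := hne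
    rw [Set.mem_iInter] at hv
    obtain ⟨P, -, rfl⟩ := (hv 0).1
    have ht : Tendsto (fun n => (P : Measure Ω) (A n : Set Ω)) atTop (𝓝 0) := by
      have := tendsto_measure_iInter_atTop (μ := (P : Measure Ω)) (s := fun n => (A n : Set Ω))
        (fun n => (A n).2.nullMeasurableSet) (fun _ _ h => hA h) ⟨0, measure_ne_top _ _⟩
      rwa [hempty, measure_empty] at this
    have ht' := (ENNReal.tendsto_toReal ENNReal.zero_ne_top).comp ht
    exact absurd (ge_of_tendsto' ht' fun n => (hv n).2) (by simpa using hε)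
  · rintro n _ ⟨⟨P, hP, rfl⟩, h⟩
    exact ⟨⟨P, hP, rfl⟩, le_trans h (measureReal_mono (hA n.le_succ))⟩
  · intro n
    obtain ⟨P, hP, h⟩ := hcon n
    exact ⟨_, ⟨P, hP, rfl⟩, h⟩

/-! ### Upper and lower probabilities; attainment on chains. -/

namespace ImpreciseBayes

variable {S C : Set (ProbabilityMeasure Ω)} {A B : Set Ω}

theorem bddAbove_real_image (S : Set (ProbabilityMeasure Ω)) (A : Set Ω) :
    BddAbove ((fun P : ProbabilityMeasure Ω => (P : Measure Ω).real A) '' S) :=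
  ⟨1, by rintro _ ⟨P, -, rfl⟩; exact measureReal_le_one⟩

/-- The condition 0 ≤ c covers empty S, where `sSup ∅ = 0`. -/
theorem upper_le_of_forall {c : ℝ} (hc : 0 ≤ c)
    (h : ∀ P ∈ S, (P : Measure Ω).real A ≤ c) : upper S A ≤ c :=
  Real.sSup_le (by rintro _ ⟨P, hP, rfl⟩; exact h P hP) hc

theorem le_upper {P : ProbabilityMeasure Ω} (hP : P ∈ S) (A : Set Ω) :
    (P : Measure Ω).real A ≤ upper S A :=
  le_csSup (bddAbove_real_image S A) ⟨P, hP, rfl⟩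

theorem upper_nonneg (S : Set (ProbabilityMeasure Ω)) (A : Set Ω) : 0 ≤ upper S A :=
  Real.sSup_nonneg (by rintro _ ⟨P, -, rfl⟩; exact measureReal_nonneg)

theorem upper_le_one (S : Set (ProbabilityMeasure Ω)) (A : Set Ω) : upper S A ≤ 1 :=
  upper_le_of_forall zero_le_one fun _ _ => measureReal_le_one

theorem upper_mono (S : Set (ProbabilityMeasure Ω)) (h : A ⊆ B) : upper S A ≤ upper S B :=
  upper_le_of_forall (upper_nonneg S B) fun P hP => (measureReal_mono h).trans (le_upper hP B)

theorem upper_empty (S : Set (ProbabilityMeasure Ω)) : upper S ∅ = 0 :=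
  le_antisymm (upper_le_of_forall le_rfl fun P _ => by simp) (upper_nonneg S _)

theorem subset_core (S : Set (ProbabilityMeasure Ω)) : S ⊆ core (upper S) :=
  fun _ hP A _ => le_upper hP A

theorem upper_univ (h : (core (upper S)).Nonempty) : upper S Set.univ = 1 := by
  obtain ⟨P, hP⟩ := h
  refine le_antisymm (upper_le_one S _) ?_
  simpa using hP Set.univ MeasurableSet.univ

theorem lower_nonneg (S : Set (ProbabilityMeasure Ω)) (A : Set Ω) : 0 ≤ lower S A :=
  sub_nonneg.2 (upper_le_one S _)

theorem lower_mono (S : Set (ProbabilityMeasure Ω)) (h : A ⊆ B) : lower S A ≤ lower S B :=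
  sub_le_sub_left (upper_mono S (Set.compl_subset_compl.2 h)) 1

theorem lower_empty (h : (core (upper S)).Nonempty) : lower S ∅ = 0 := by
  rw [lower, Set.compl_empty, upper_univ h, sub_self]

theorem lower_le_real {P : ProbabilityMeasure Ω} (hP : P ∈ core (upper S))
    (hA : MeasurableSet A) : lower S A ≤ (P : Measure Ω).real A := by
  have := hP Aᶜ hA.compl
  rw [probReal_compl_eq_one_sub hA] at this
  rw [lower]
  linarith

/-- A concave upper probability with weak-star closed core is attained on a whole chain of
measurable sets by one member of the core. -/
theorem exists_mem_core_eq_upper_on_chain (hne : (core (upper S)).Nonempty)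
    (hclosed : WeakStarClosed (core (upper S))) (hconc : Concave (upper S))
    (K : Set (Set Ω)) (hKm : ∀ A ∈ K, MeasurableSet A) (hK : IsChain (· ⊆ ·) K) :
    ∃ P ∈ core (upper S), ∀ A ∈ K, (P : Measure Ω).real A = upper S A := by
  have hu : NormalizedSubmodular (fun A : {A : Set Ω // MeasurableSet A} => upper S A) :=
    ⟨upper_empty S, upper_univ hne, fun A B => by
      have := hconc A B A.2 B.2
      change upper S (A ∪ B : Set Ω) + upper S (A ∩ B : Set Ω) ≤ _
      linarith⟩
  obtain ⟨m, hmu, hmK, htop, hcompl, hadd⟩ := hu.exists_additive {A | (A : Set Ω) ∈ K}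
    (fun A hA B hB hAB => hK hA hB fun h => hAB (Subtype.ext h))
  have hnn : ∀ A, 0 ≤ m A := fun A => by
    have h1 := hmu Aᶜ
    have h2 := upper_le_one S ((Aᶜ : {A : Set Ω // MeasurableSet A}) : Set Ω)
    have h3 := hcompl A
    simp only at h1
    linarith
  have hcont : ∀ A : ℕ → {A : Set Ω // MeasurableSet A}, Antitone A →
      ⋂ n, (A n : Set Ω) = ∅ → Tendsto (fun n => m (A n)) atTop (𝓝 0) := by
    intro A hA hempty
    refine tendsto_order.2 ⟨fun a ha => Eventually.of_forall fun n => ha.trans_le (hnn _), ?_⟩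
    intro ε hε
    -- A strict bound on each member yields only a weak bound on the supremum, hence ε/2.
    obtain ⟨n, hn⟩ := hclosed.exists_forall_lt A hA hempty (half_pos hε)
    filter_upwards [eventually_ge_atTop n] with k hk
    calc m (A k) ≤ upper S (A k) := hmu (A k)
      _ ≤ upper S (A n) := upper_mono S (hA hk)
      _ ≤ ε / 2 := upper_le_of_forall (half_pos hε).le fun P hP => (hn P (subset_core S hP)).le
      _ < ε := half_lt_self hε
  obtain ⟨P, hP⟩ := exists_probabilityMeasure_of_tendsto_zero m hnn htop hadd hcont
  exact ⟨P, fun A hA => (hP ⟨A, hA⟩).trans_le (hmu ⟨A, hA⟩), fun A hA =>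
    (hP ⟨A, hKm A hA⟩).trans (hmK ⟨A, hKm A hA⟩ hA)⟩

end ImpreciseBayes

/-! ### Expectations over the core and Choquet integrals. -/

namespace ImpreciseBayes

variable {S C : Set (ProbabilityMeasure Ω)} {A : Set Ω} {f : Ω → ℝ} {P : ProbabilityMeasure Ω}

theorem indicator_mem_bddNonnegMeasurable (hf : f ∈ BddNonnegMeasurable Ω)
    (hA : MeasurableSet A) : A.indicator f ∈ BddNonnegMeasurable Ω := by
  obtain ⟨hm, hnn, M, hM⟩ := hf
  exact ⟨hm.indicator hA, fun θ => Set.indicator_nonneg (fun θ _ => hnn θ) θ,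
    M, fun θ => (Set.indicator_le_self' (fun θ _ => hnn θ) θ).trans (hM θ)⟩

theorem integrable_of_mem (hf : f ∈ BddNonnegMeasurable Ω) (P : ProbabilityMeasure Ω) :
    Integrable f (P : Measure Ω) := by
  obtain ⟨hm, hnn, M, hM⟩ := hf
  exact Integrable.of_bound hm.aestronglyMeasurable M
    (Eventually.of_forall fun θ => by rw [Real.norm_eq_abs, abs_of_nonneg (hnn θ)]; exact hM θ)

theorem integral_nonneg_of_mem (hf : f ∈ BddNonnegMeasurable Ω) (P : ProbabilityMeasure Ω) :
    0 ≤ ∫ θ, f θ ∂(P : Measure Ω) := integral_nonneg hf.2.1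

theorem integral_eq_integral_real_lt (hf : f ∈ BddNonnegMeasurable Ω) (P : ProbabilityMeasure Ω) :
    ∫ θ, f θ ∂(P : Measure Ω) = ∫ t in Set.Ioi (0 : ℝ), (P : Measure Ω).real {θ | t < f θ} :=
  (integrable_of_mem hf P).integral_eq_integral_meas_lt (Eventually.of_forall hf.2.1)

/-- The integrand is antitone in t, hence integrable on [0, M], and it vanishes above a bound M of
f. -/
theorem integrableOn_superlevel {v : Set Ω → ℝ} (hv : ∀ A B, A ⊆ B → v A ≤ v B) (h0 : v ∅ = 0)
    (hf : f ∈ BddNonnegMeasurable Ω) :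
    IntegrableOn (fun t : ℝ => v {θ | t < f θ}) (Set.Ioi 0) := by
  obtain ⟨M, hM⟩ := hf.2.2
  have hanti : Antitone fun t : ℝ => v {θ | t < f θ} :=
    fun s t hst => hv _ _ fun θ hθ => lt_of_le_of_lt hst hθ
  have h1 : IntegrableOn (fun t : ℝ => v {θ | t < f θ}) (Set.Icc 0 M) :=
    (hanti.antitoneOn _).integrableOn_isCompact isCompact_Icc
  have h2 : IntegrableOn (fun t : ℝ => v {θ | t < f θ}) (Set.Ioi M) := by
    refine (integrableOn_congr_fun (g := fun _ => (0 : ℝ)) (fun t ht => ?_)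
      measurableSet_Ioi).2 integrableOn_zero
    rw [← h0]
    exact congrArg v (Set.eq_empty_of_forall_notMem fun θ hθ =>
      absurd ((hM θ).trans_lt ht) (not_lt.2 (le_of_lt hθ)))
  refine (h1.union h2).mono_set fun t ht => ?_
  rcases le_or_gt t M with h | h
  · exact Or.inl ⟨le_of_lt ht, h⟩
  · exact Or.inr h

theorem integrableOn_real_superlevel (hf : f ∈ BddNonnegMeasurable Ω) (P : ProbabilityMeasure Ω) :
    IntegrableOn (fun t : ℝ => (P : Measure Ω).real {θ | t < f θ}) (Set.Ioi 0) :=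
  integrableOn_superlevel (fun _ _ h => measureReal_mono h) (by simp) hf

theorem choquet_nonneg {Θ : Type*} {v : Set Θ → ℝ} (hv : ∀ A, 0 ≤ v A) (f : Θ → ℝ) : 0 ≤ choquet v f :=
  integral_nonneg fun _ => hv _

theorem integral_le_choquet_upper (hf : f ∈ BddNonnegMeasurable Ω) (hP : P ∈ core (upper S)) :
    ∫ θ, f θ ∂(P : Measure Ω) ≤ choquet (upper S) f := by
  rw [integral_eq_integral_real_lt hf]
  exact setIntegral_mono (integrableOn_real_superlevel hf P)
    (integrableOn_superlevel (fun _ _ => upper_mono S) (upper_empty S) hf)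
    fun t => hP _ (measurableSet_lt measurable_const hf.1)

theorem choquet_lower_le_integral (hf : f ∈ BddNonnegMeasurable Ω) (hP : P ∈ core (upper S)) :
    choquet (lower S) f ≤ ∫ θ, f θ ∂(P : Measure Ω) := by
  rw [integral_eq_integral_real_lt hf]
  exact setIntegral_mono
    (integrableOn_superlevel (fun _ _ => lower_mono S) (lower_empty ⟨P, hP⟩) hf)
    (integrableOn_real_superlevel hf P)
    fun t => lower_le_real hP (measurableSet_lt measurable_const hf.1)

theorem bddAbove_integral_image (hf : f ∈ BddNonnegMeasurable Ω)
    (C : Set (ProbabilityMeasure Ω)) :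
    BddAbove ((fun P : ProbabilityMeasure Ω => ∫ θ, f θ ∂(P : Measure Ω)) '' C) := by
  obtain ⟨M, hM⟩ := hf.2.2
  refine ⟨M, ?_⟩
  rintro _ ⟨P, -, rfl⟩
  simpa using integral_mono (integrable_of_mem hf P) (integrable_const M) hM

theorem integral_le_upperExp (hf : f ∈ BddNonnegMeasurable Ω) (hP : P ∈ C) :
    ∫ θ, f θ ∂(P : Measure Ω) ≤ upperExp C f :=
  le_csSup (bddAbove_integral_image hf C) ⟨P, hP, rfl⟩

theorem lowerExp_le_integral (hf : f ∈ BddNonnegMeasurable Ω) (hP : P ∈ C) :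
    lowerExp C f ≤ ∫ θ, f θ ∂(P : Measure Ω) :=
  csInf_le ⟨0, by rintro _ ⟨P, -, rfl⟩; exact integral_nonneg_of_mem hf P⟩ ⟨P, hP, rfl⟩

theorem upperExp_nonneg (hf : f ∈ BddNonnegMeasurable Ω) (C : Set (ProbabilityMeasure Ω)) :
    0 ≤ upperExp C f :=
  Real.sSup_nonneg (by rintro _ ⟨P, -, rfl⟩; exact integral_nonneg_of_mem hf P)

theorem lowerExp_nonneg (hf : f ∈ BddNonnegMeasurable Ω) (C : Set (ProbabilityMeasure Ω)) :
    0 ≤ lowerExp C f :=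
  Real.sInf_nonneg (by rintro _ ⟨P, -, rfl⟩; exact integral_nonneg_of_mem hf P)

theorem upperExp_le_choquet (hf : f ∈ BddNonnegMeasurable Ω) (S : Set (ProbabilityMeasure Ω)) :
    upperExp (core (upper S)) f ≤ choquet (upper S) f :=
  Real.sSup_le (by rintro _ ⟨P, hP, rfl⟩; exact integral_le_choquet_upper hf hP)
    (choquet_nonneg (upper_nonneg S) f)

theorem choquet_le_lowerExp (hf : f ∈ BddNonnegMeasurable Ω) (hne : (core (upper S)).Nonempty) :
    choquet (lower S) f ≤ lowerExp (core (upper S)) f :=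
  le_csInf (hne.image _) (by rintro _ ⟨P, hP, rfl⟩; exact choquet_lower_le_integral hf hP)

/-- The upper Choquet integral vanishes as soon as the upper expectation does. -/
theorem choquet_upper_eq_zero (hf : f ∈ BddNonnegMeasurable Ω)
    (h : upperExp (core (upper S)) f = 0) : choquet (upper S) f = 0 := by
  refine setIntegral_eq_zero_of_forall_eq_zero fun t ht => ?_
  refine le_antisymm (upper_le_of_forall le_rfl fun P hP => ?_) (upper_nonneg S _)
  have h0 : ∫ θ, f θ ∂(P : Measure Ω) = 0 :=
    le_antisymm ((integral_le_upperExp hf (subset_core S hP)).trans_eq h)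
      (integral_nonneg_of_mem hf P)
  have hae := (integral_eq_zero_iff_of_nonneg hf.2.1 (integrable_of_mem hf P)).1 h0
  have hnull : (P : Measure Ω) {θ | t < f θ} = 0 := by
    refine measure_mono_null (fun θ hθ => ?_) (ae_iff.1 hae)
    exact ((Set.mem_Ioi.1 ht).trans hθ).ne'
  rw [measureReal_def, hnull, ENNReal.toReal_zero]

/-- Under concavity, one member of the core attains both the upper Choquet integral of `f 1_A` and
the lower Choquet integral of `f 1_{Aᶜ}`. -/
theorem exists_mem_core_integral_eq_choquet (hne : (core (upper S)).Nonempty)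
    (hclosed : WeakStarClosed (core (upper S))) (hconc : Concave (upper S))
    (hf : f ∈ BddNonnegMeasurable Ω) (hA : MeasurableSet A) :
    ∃ P ∈ core (upper S),
      ∫ θ, A.indicator f θ ∂(P : Measure Ω) = choquet (upper S) (A.indicator f) ∧
      ∫ θ, Aᶜ.indicator f θ ∂(P : Measure Ω) = choquet (lower S) (Aᶜ.indicator f) := by
  have hf₁ := indicator_mem_bddNonnegMeasurable hf hA
  have hf₂ := indicator_mem_bddNonnegMeasurable hf hA.compl
  set U : ℝ → Set Ω := fun t => {θ | t < A.indicator f θ}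
  -- Complements, because attaining the lower probability on a set means attaining the upper one on
  -- its complement.
  set V : ℝ → Set Ω := fun t => {θ | t < Aᶜ.indicator f θ}ᶜ
  have hUm : ∀ t, MeasurableSet (U t) := fun t => measurableSet_lt measurable_const hf₁.1
  have hVm : ∀ t, MeasurableSet (V t) := fun t =>
    (measurableSet_lt measurable_const hf₂.1).compl
  have hU : ∀ s t, s ≤ t → U t ⊆ U s := fun s t hst θ hθ => lt_of_le_of_lt hst hθ
  have hV : ∀ s t, s ≤ t → V s ⊆ V t := fun s t hst θ hθ h => hθ (lt_of_le_of_lt hst h)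
  have hUV : ∀ s t, 0 < s → 0 < t → U s ⊆ V t := by
    intro s t hs ht θ hθ h
    by_cases hA : θ ∈ A
    · have h : t < Aᶜ.indicator f θ := h
      simp only [Set.indicator, Set.mem_compl_iff, hA, not_true_eq_false, if_false] at h
      exact lt_asymm ht h
    · have h : s < A.indicator f θ := hθ
      simp only [Set.indicator, hA, if_false] at h
      exact lt_asymm hs h
  obtain ⟨P, hP, hK⟩ := exists_mem_core_eq_upper_on_chain hne hclosed hconc
    (U '' Set.Ioi 0 ∪ V '' Set.Ioi 0) (by
      rintro _ (⟨t, -, rfl⟩ | ⟨t, -, rfl⟩)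
      exacts [hUm t, hVm t]) (by
      rintro _ (⟨s, hs, rfl⟩ | ⟨s, hs, rfl⟩) _ (⟨t, ht, rfl⟩ | ⟨t, ht, rfl⟩) -
      · exact (le_total t s).imp (hU _ _) (hU _ _)
      · exact Or.inl (hUV s t hs ht)
      · exact Or.inr (hUV t s ht hs)
      · exact (le_total s t).imp (hV _ _) (hV _ _))
  refine ⟨P, hP, ?_, ?_⟩
  · rw [integral_eq_integral_real_lt hf₁]
    exact setIntegral_congr_fun measurableSet_Ioi fun t ht => hK _ (Or.inl ⟨t, ht, rfl⟩)
  · rw [integral_eq_integral_real_lt hf₂]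
    refine setIntegral_congr_fun measurableSet_Ioi fun t ht => ?_
    have h : (P : Measure Ω).real (V t) = upper S (V t) := hK _ (Or.inr ⟨t, ht, rfl⟩)
    simp only [lower]
    rw [← h, probReal_compl_eq_one_sub (measurableSet_lt measurable_const hf₂.1), sub_sub_cancel]

/-! ### Posteriors and their bounds. -/

theorem integral_eq_indicator_add (hf : f ∈ BddNonnegMeasurable Ω) (hA : MeasurableSet A)
    (P : ProbabilityMeasure Ω) :
    ∫ θ, f θ ∂(P : Measure Ω) =
      ∫ θ, A.indicator f θ ∂(P : Measure Ω) + ∫ θ, Aᶜ.indicator f θ ∂(P : Measure Ω) := by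
  rw [integral_indicator hA, integral_indicator hA.compl,
    integral_add_compl hA (integrable_of_mem hf P)]

theorem exists_precisePosterior (hf : f ∈ BddNonnegMeasurable Ω) (P : ProbabilityMeasure Ω)
    (hpos : 0 < ∫ θ, f θ ∂(P : Measure Ω)) :
    ∃ R : ProbabilityMeasure Ω, ∀ A, MeasurableSet A →
      (R : Measure Ω).real A = (∫ θ in A, f θ ∂(P : Measure Ω)) / ∫ θ, f θ ∂(P : Measure Ω) := by
  set c := ∫ θ, f θ ∂(P : Measure Ω) with hc
  have hnn : ∀ θ, 0 ≤ f θ / c := fun θ => div_nonneg (hf.2.1 θ) hpos.le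
  have hR : ∀ A, MeasurableSet A →
      (P : Measure Ω).withDensity (fun θ => ENNReal.ofReal (f θ / c)) A =
        ENNReal.ofReal ((∫ θ in A, f θ ∂(P : Measure Ω)) / c) := by
    intro A hA
    rw [withDensity_apply _ hA, ← integral_div,
      ofReal_integral_eq_lintegral_ofReal ((integrable_of_mem hf P).integrableOn.div_const c)
        (Eventually.of_forall hnn)]
  refine ⟨⟨(P : Measure Ω).withDensity (fun θ => ENNReal.ofReal (f θ / c)), ⟨?_⟩⟩, fun A hA => ?_⟩
  · rw [hR _ MeasurableSet.univ, setIntegral_univ, ← hc, div_self hpos.ne', ENNReal.ofReal_one]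
  · change ((P : Measure Ω).withDensity (fun θ => ENNReal.ofReal (f θ / c)) A).toReal = _
    rw [hR A hA, ENNReal.toReal_ofReal (div_nonneg (integral_nonneg hf.2.1) hpos.le)]

/-- For priors dominated by `μ` and a single likelihood function, the posteriors given by
`μ`-densities are those given by Bayes' rule. -/
theorem posteriors_singleton (μ : Measure Ω) [SigmaFinite μ]
    (hμ : ∀ P ∈ C, (P : Measure Ω) ≪ μ) (hf : f ∈ BddNonnegMeasurable Ω) :
    posteriors μ C {f} = precisePosteriors C f := by
  ext R
  simp only [posteriors, precisePosteriors, Set.mem_ofPred_eq, Set.mem_singleton_iff,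
    exists_eq_left]
  refine exists_congr fun P => and_congr_right fun hP => ?_
  -- Absolute continuity turns integration against dP/dμ into integration against P.
  have hset : ∀ A, ∫ θ in A, f θ * ((P : Measure Ω).rnDeriv μ θ).toReal ∂μ =
      ∫ θ in A, f θ ∂(P : Measure Ω) := fun A => by
    rw [← setIntegral_rnDeriv_smul' (hμ P hP)]
    simp only [smul_eq_mul, mul_comm]
  have hint : ∫ θ, f θ * ((P : Measure Ω).rnDeriv μ θ).toReal ∂μ =
      ∫ θ, f θ ∂(P : Measure Ω) := by
    simpa using hset Set.univ
  rw [hint]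
  refine and_congr_right fun hpos => ?_
  set c := ∫ θ, f θ ∂(P : Measure Ω)
  have hI : Integrable (fun θ => f θ * ((P : Measure Ω).rnDeriv μ θ).toReal) μ := by
    have := (integrable_rnDeriv_smul_iff (f := f) (hμ P hP)).2 (integrable_of_mem hf P)
    simpa only [smul_eq_mul, mul_comm] using this
  have hR : ∀ A, MeasurableSet A →
      μ.withDensity (fun θ => ENNReal.ofReal
        (f θ * ((P : Measure Ω).rnDeriv μ θ).toReal / c)) A =
        ENNReal.ofReal ((∫ θ in A, f θ ∂(P : Measure Ω)) / c) := by
    intro A hA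
    rw [withDensity_apply _ hA, ← hset A, ← integral_div,
      ofReal_integral_eq_lintegral_ofReal (hI.integrableOn.div_const c)
        (Eventually.of_forall fun θ =>
          div_nonneg (mul_nonneg (hf.2.1 θ) ENNReal.toReal_nonneg) hpos.le)]
  constructor
  · intro h A hA
    rw [measureReal_def, h, hR A hA,
      ENNReal.toReal_ofReal (div_nonneg (integral_nonneg hf.2.1) hpos.le)]
  · intro h
    refine Measure.ext fun A hA => ?_
    rw [hR A hA, ← h A hA, measureReal_def, ENNReal.ofReal_toReal (measure_ne_top _ _)]

theorem upper_precisePosteriors_le (hf : f ∈ BddNonnegMeasurable Ω) (hA : MeasurableSet A)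
    (hpos : 0 < expNormalizer C f f A) :
    upper (precisePosteriors C f) A ≤
      upperExp C (A.indicator f) / expNormalizer C f f A := by
  have hf₁ := indicator_mem_bddNonnegMeasurable hf hA
  have hf₂ := indicator_mem_bddNonnegMeasurable hf hA.compl
  refine upper_le_of_forall (div_nonneg (upperExp_nonneg hf₁ C) hpos.le) ?_
  rintro R ⟨P, hP, hP0, hR⟩
  -- With X the supremum and Z the infimum, x/(x+z) ≤ X/(X+Z) cross-multiplies to xZ ≤ Xz.
  rw [hR A hA, div_le_div_iff₀ hP0 hpos, integral_eq_indicator_add hf hA P, expNormalizer,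
    ← integral_indicator hA, mul_add, mul_add]
  refine add_le_add (mul_comm _ _).le ?_
  exact mul_le_mul (integral_le_upperExp hf₁ hP) (lowerExp_le_integral hf₂ hP)
    (lowerExp_nonneg hf₂ C) (upperExp_nonneg hf₁ C)

/-- If the upper expectation vanishes, so does the upper Choquet integral; positivity then comes
from the lower Choquet integral, which the lower expectation dominates. -/
theorem expNormalizer_pos (hne : (core (upper S)).Nonempty) (hf : f ∈ BddNonnegMeasurable Ω)
    (hA : MeasurableSet A) (hpos : 0 < choquetNormalizer S f f A) :
    0 < expNormalizer (core (upper S)) f f A := by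
  have hf₁ := indicator_mem_bddNonnegMeasurable hf hA
  have hf₂ := indicator_mem_bddNonnegMeasurable hf hA.compl
  rcases (upperExp_nonneg hf₁ (core (upper S))).eq_or_lt with h | h
  · rw [choquetNormalizer, choquet_upper_eq_zero hf₁ h.symm, zero_add] at hpos
    rw [expNormalizer, ← h, zero_add]
    exact hpos.trans_le (choquet_le_lowerExp hf₂ hne)
  · exact add_pos_of_pos_of_nonneg h (lowerExp_nonneg hf₂ _)

theorem upperExp_div_le_choquet_div (hne : (core (upper S)).Nonempty)
    (hf : f ∈ BddNonnegMeasurable Ω) (hA : MeasurableSet A)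
    (hpos : 0 < choquetNormalizer S f f A) :
    upperExp (core (upper S)) (A.indicator f) / expNormalizer (core (upper S)) f f A ≤
      choquet (upper S) (A.indicator f) / choquetNormalizer S f f A := by
  have hf₁ := indicator_mem_bddNonnegMeasurable hf hA
  have hf₂ := indicator_mem_bddNonnegMeasurable hf hA.compl
  rw [div_le_div_iff₀ (expNormalizer_pos hne hf hA hpos) hpos, choquetNormalizer, expNormalizer,
    mul_add, mul_add]
  refine add_le_add (mul_comm _ _).le ?_
  exact mul_le_mul (upperExp_le_choquet hf₁ S) (choquet_le_lowerExp hf₂ hne)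
    (choquet_nonneg (lower_nonneg S) _) (choquet_nonneg (upper_nonneg S) _)

/-- Under concavity one member of the core attains the upper expectation of `f 1_A` and the lower
expectation of `f 1_{Aᶜ}`, and both are Choquet integrals. -/
theorem exists_mem_core_attaining (hne : (core (upper S)).Nonempty)
    (hclosed : WeakStarClosed (core (upper S))) (hconc : Concave (upper S))
    (hf : f ∈ BddNonnegMeasurable Ω) (hA : MeasurableSet A) :
    upperExp (core (upper S)) (A.indicator f) = choquet (upper S) (A.indicator f) ∧
    lowerExp (core (upper S)) (Aᶜ.indicator f) = choquet (lower S) (Aᶜ.indicator f) ∧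
    ∃ P ∈ core (upper S),
      ∫ θ, A.indicator f θ ∂(P : Measure Ω) = upperExp (core (upper S)) (A.indicator f) ∧
      ∫ θ, Aᶜ.indicator f θ ∂(P : Measure Ω) = lowerExp (core (upper S)) (Aᶜ.indicator f) := by
  have hf₁ := indicator_mem_bddNonnegMeasurable hf hA
  have hf₂ := indicator_mem_bddNonnegMeasurable hf hA.compl
  obtain ⟨P, hP, h1, h2⟩ := exists_mem_core_integral_eq_choquet hne hclosed hconc hf hA
  have h3 : upperExp (core (upper S)) (A.indicator f) = choquet (upper S) (A.indicator f) :=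
    le_antisymm (upperExp_le_choquet hf₁ S) (h1.symm.trans_le (integral_le_upperExp hf₁ hP))
  have h4 : lowerExp (core (upper S)) (Aᶜ.indicator f) =
      choquet (lower S) (Aᶜ.indicator f) :=
    le_antisymm ((lowerExp_le_integral hf₂ hP).trans_eq h2) (choquet_le_lowerExp hf₂ hne)
  exact ⟨h3, h4, P, hP, h1.trans h3.symm, h2.trans h4.symm⟩

/-- A prior attaining both extremes has total ∫ f dP equal to the normalizer, so its own posterior
realizes the bound. -/
theorem le_upper_precisePosteriors (hf : f ∈ BddNonnegMeasurable Ω) (hA : MeasurableSet A)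
    (hpos : 0 < expNormalizer C f f A) (hP : P ∈ C)
    (h₁ : ∫ θ, A.indicator f θ ∂(P : Measure Ω) = upperExp C (A.indicator f))
    (h₂ : ∫ θ, Aᶜ.indicator f θ ∂(P : Measure Ω) = lowerExp C (Aᶜ.indicator f)) :
    upperExp C (A.indicator f) / expNormalizer C f f A ≤ upper (precisePosteriors C f) A := by
  have hc : ∫ θ, f θ ∂(P : Measure Ω) = expNormalizer C f f A := by
    rw [integral_eq_indicator_add hf hA P, h₁, h₂, expNormalizer]
  obtain ⟨R, hR⟩ := exists_precisePosterior hf P (hc ▸ hpos)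
  have := le_upper (S := precisePosteriors C f) (P := R) ⟨P, hP, hc ▸ hpos, hR⟩ A
  rwa [hR A hA, ← integral_indicator hA, h₁, hc] at this

theorem likelihoods_eq_singleton {Θ D : Type*} [MeasurableSpace D]
    {ℒ : Θ → Set (ProbabilityMeasure D)} {dens : Θ → ProbabilityMeasure D → D → ℝ} {y : D}
    {P₀ : Θ → ProbabilityMeasure D} (hsingle : ∀ θ, core (upper (ℒ θ)) = {P₀ θ})
    {L : Θ → ℝ} (hL : ∀ θ, L θ = dens θ (P₀ θ) y) : likelihoods ℒ dens y = {L} := by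
  ext g
  simp only [likelihoods, hsingle, Set.mem_singleton_iff, Set.mem_ofPred_eq]
  constructor
  · rintro ⟨Q, hQ, hg⟩
    exact funext fun θ => by rw [hg, hQ, hL]
  · rintro rfl
    exact ⟨P₀, fun _ => rfl, hL⟩

end ImpreciseBayes

end ImpreciseProbability

/-! ### Assembly for a precise likelihood. -/

theorem corollary1 {Θ D : Type*} [MeasurableSpace Θ] [MeasurableSpace D]
    (μ : Measure Θ) [SigmaFinite μ]
    (ν : Measure D) [SigmaFinite ν]
    -- the prior set, with nonempty weak-star closed core dominated by `μ`
    (Pr : Set (ProbabilityMeasure Θ))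
    (hne : (core (upper Pr)).Nonempty)
    (hclosed : WeakStarClosed (core (upper Pr)))
    (hμ : ∀ P ∈ core (upper Pr),
      Measure.AbsolutelyContinuous (P : Measure Θ) μ)
    -- the sets of sampling distributions, with densities, and the observation `y`
    (ℒ : Θ → Set (ProbabilityMeasure D))
    (dens : Θ → ProbabilityMeasure D → D → ℝ)
    (hdens : ∀ θ, ∀ Q ∈ core (upper (ℒ θ)),
      IsDensity ν Q (dens θ Q))
    (y : D)
    (hbdd : likelihoods ℒ dens y ⊆ BddNonnegMeasurable Θ)
    -- the likelihood core is a singleton; `L` is the resulting likelihood function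
    (P₀ : Θ → ProbabilityMeasure D)
    (hsingle : ∀ θ, core (upper (ℒ θ)) = {P₀ θ})
    (L : Θ → ℝ) (hL : ∀ θ, L θ = dens θ (P₀ θ) y) :
    -- upper and lower likelihood both reduce to `L`
    upperLikelihood (likelihoods ℒ dens y) = L ∧
    lowerLikelihood (likelihoods ℒ dens y) = L ∧
    -- the posteriors are those of Bayes' rule with the precise likelihood `L`
    posteriors μ (core (upper Pr))
        (likelihoods ℒ dens y) =
      precisePosteriors (core (upper Pr)) L ∧
    -- the two bounds on the upper posterior probability
    (∀ A : Set Θ, MeasurableSet A →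
      (0 < expNormalizer (core (upper Pr)) L L A →
        upper (posteriors μ
            (core (upper Pr))
            (likelihoods ℒ dens y)) A ≤
          upperExp (core (upper Pr)) (A.indicator L) /
            expNormalizer (core (upper Pr)) L L A) ∧
      (0 < choquetNormalizer Pr L L A →
        0 < expNormalizer (core (upper Pr)) L L A ∧
        upperExp (core (upper Pr)) (A.indicator L) /
            expNormalizer (core (upper Pr)) L L A ≤
          choquet (upper Pr) (A.indicator L) /
            choquetNormalizer Pr L L A)) ∧
    -- both are equalities if the upper prior probability is concave
    (Concave (upper Pr) → ∀ A : Set Θ, MeasurableSet A →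
      (0 < expNormalizer (core (upper Pr)) L L A →
        upper (posteriors μ
            (core (upper Pr))
            (likelihoods ℒ dens y)) A =
          upperExp (core (upper Pr)) (A.indicator L) /
            expNormalizer (core (upper Pr)) L L A) ∧
      (0 < choquetNormalizer Pr L L A →
        upperExp (core (upper Pr)) (A.indicator L) /
            expNormalizer (core (upper Pr)) L L A =
          choquet (upper Pr) (A.indicator L) /
            choquetNormalizer Pr L L A)) := by
  rw [likelihoods_eq_singleton hsingle hL] at hbdd ⊢
  have hLm : L ∈ BddNonnegMeasurable Θ := hbdd rfl
  rw [posteriors_singleton μ hμ hLm]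
  refine ⟨funext fun θ => by simp [upperLikelihood], funext fun θ => by simp [lowerLikelihood],
    rfl, fun A hA => ⟨upper_precisePosteriors_le hLm hA, fun hpos =>
      ⟨expNormalizer_pos hne hLm hA hpos, upperExp_div_le_choquet_div hne hLm hA hpos⟩⟩,
    fun hconc A hA => ?_⟩
  obtain ⟨h1, h2, P, hP, h3, h4⟩ := exists_mem_core_attaining hne hclosed hconc hLm hA
  refine ⟨fun hpos => le_antisymm (upper_precisePosteriors_le hLm hA hpos)
    (le_upper_precisePosteriors hLm hA hpos hP h3 h4), fun _ => ?_⟩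
  rw [expNormalizer, choquetNormalizer, h1, h2]
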